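/- All rings are commutative with unity. A ring $R$ is \emph{semilocal} if it has only finitely many maximal ideals, and \emph{arithmetic} if, for every maximal ideal $P$ of $R$, the ideals of the localization $R_P$ are totally ordered by inclusion. A submodule $F$ of an $R$-module $M$ is \emph{pure} if, for every $R$-module $N$, the map $F\otimes_R N\to M\otimes_R N$ induced by the inclusion is injective. Let $R$ be a semilocal arithmetic ring and let $M$ be a finitely generated $R$-module. Then $M$ has a pure-composition series with cyclic factors and an increasing annihilator sequence; that is, there are an integer $n\ge 0$ and a finite chain of submodules \[\{0\}=M_0\subsetneq M_1\subsetneq\dots\subsetneq M_n=M\] such that every $M_i$ is a pure submodule of $M$, every factor $M_i/M_{i-1}$ ($1\le i\le n$) is a cyclic $R$-module, and the annihilators $A_i=\operatorname{ann}_R(M_i/M_{i-1})$ satisfy $A_1\subseteq A_2\subseteq\dots\subseteq A_n$. -/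

import Mathlib

universe u v

/-- A module is uniserial if its submodules are totally ordered by inclusion. -/
def IsUniserialModule (R : Type u) [CommRing R] (M : Type v) [AddCommGroup M] [Module R M] : Prop :=
  ∀ N₁ N₂ : Submodule R M, N₁ ≤ N₂ ∨ N₂ ≤ N₁

/-- A commutative ring, possibly with zero divisors, is a valuation ring if it is uniserial as a
module over itself. (Mathlib's `ValuationRing` only covers domains.) -/
def IsUniserialRing (R : Type u) [CommRing R] : Prop :=
  IsUniserialModule R R

/-- A ring is arithmetic if its localization at every maximal ideal is a valuation ring. -/
def IsArithmeticRing (R : Type u) [CommRing R] : Prop :=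
  ∀ (P : Ideal R) [P.IsMaximal], IsUniserialRing (Localization.AtPrime P)

/-- A commutative ring is semilocal if it has only finitely many maximal ideals. -/
def IsSemilocalRing (R : Type u) [CommRing R] : Prop :=
  {P : Ideal R | P.IsMaximal}.Finite

/-- `F` is a pure submodule of `M`: the sequence `0 → F → M → M ⧸ F → 0` stays exact after
tensoring with any module `N`. As the tensor product is right exact, this says that
`F ⊗ N → M ⊗ N` is injective. The universe of `N` contains copies of all modules that live in the
universe of `R` or in that of `M`. -/
def IsPureSubmodule {R : Type u} [CommRing R] {M : Type v} [AddCommGroup M] [Module R M]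
    (F : Submodule R M) : Prop :=
  ∀ (N : Type (max u v)) [AddCommGroup N] [Module R N],
    Function.Injective (F.subtype.rTensor N)

/-- A finite chain `0 = M₀ ⊂ M₁ ⊂ ⋯ ⊂ Mₙ = M` of pure submodules of `M`, with strict inclusions. -/
structure PureCompositionSeries (R : Type u) [CommRing R] (M : Type v) [AddCommGroup M]
    [Module R M] where
  /-- The number `n` of factors. -/
  length : ℕ
  /-- The terms `M₀, …, Mₙ`. -/
  term : Fin (length + 1) → Submodule R M
  strictMono : StrictMono term
  term_zero : term 0 = ⊥
  term_last : term (Fin.last length) = ⊤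
  isPure : ∀ i, IsPureSubmodule (term i)

namespace PureCompositionSeries

variable {R : Type u} [CommRing R] {M : Type v} [AddCommGroup M] [Module R M]

/-- The factor `Mᵢ₊₁ / Mᵢ`, for `0 ≤ i < n`. -/
abbrev Factor (s : PureCompositionSeries R M) (i : Fin s.length) : Type v :=
  s.term i.succ ⧸ (s.term i.castSucc).submoduleOf (s.term i.succ)

/-- All the factors are cyclic modules. -/
def HasCyclicFactors (s : PureCompositionSeries R M) : Prop :=
  ∀ i, ∃ x : s.Factor i, Submodule.span R {x} = ⊤

/-- The annihilator sequence, that is, the sequence of the annihilators of the factors. -/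
def annihilatorSequence (s : PureCompositionSeries R M) (i : Fin s.length) : Ideal R :=
  Module.annihilator R (s.Factor i)

end PureCompositionSeries

/-! Where divisibility is locally total, linear systems can be solved by elimination with a pivot
dividing every coefficient, so purity reduces to `IsRDSubmodule` (`IsRDSubmodule.exists_solution`).
The series is then built greedily. Given `F`, at each maximal `P` the `s`-torsion submodules of `M ⧸
F`, for `s` not locally killing `M ⧸ F`, have images in `M ⧸ PM` forming a chain of proper
subspaces. An `x` outside the largest is faithful at `P` (`exists_isFaithfulAt`), and the Chinese
remainder theorem gives one `x` for all `P`. Faithfulness makes `F + Rx` relatively divisible again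
(`IsRDSubmodule.sup_span_singleton`). It also makes the annihilator of `x` modulo `F` equal to that
of `M ⧸ F`, which can only grow with `F`. The process stops because each `M ⧸ PM` is
finite-dimensional and there are finitely many `P`. -/

section

variable {R : Type u} [CommRing R] {M : Type v} [AddCommGroup M] [Module R M]

/-- Divisibility is total at the prime `P`: any two elements are comparable up to a factor
outside `P`. -/
def TotalDvdAt (P : Ideal R) : Prop :=
  ∀ a b : R, ∃ u ∉ P, a ∣ u * b ∨ b ∣ u * a

theorem IsArithmeticRing.totalDvdAt (h : IsArithmeticRing R) (P : Ideal R) [P.IsMaximal] :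
    TotalDvdAt P := by
  have key : ∀ a b : R, Ideal.span {algebraMap R (Localization.AtPrime P) b} ≤
      Ideal.span {algebraMap R (Localization.AtPrime P) a} → ∃ u ∉ P, a ∣ u * b := by
    intro a b hab
    obtain ⟨c, hc⟩ := Ideal.span_singleton_le_span_singleton.1 hab
    obtain ⟨⟨d, w⟩, hd⟩ := IsLocalization.surj P.primeCompl c
    have h1 : algebraMap R (Localization.AtPrime P) (w * b) = algebraMap R _ (a * d) := by
      rw [map_mul, map_mul, ← hd, hc]
      ring
    obtain ⟨t, ht⟩ := (IsLocalization.eq_iff_exists P.primeCompl _).1 h1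
    refine ⟨t * w, (t * w).2, t * d, ?_⟩
    rw [mul_assoc, ht]
    ring
  intro a b
  rcases h P (Ideal.span {algebraMap R _ b}) (Ideal.span {algebraMap R _ a}) with hab | hab
  · obtain ⟨u, hu, hd⟩ := key a b hab
    exact ⟨u, hu, .inl hd⟩
  · obtain ⟨u, hu, hd⟩ := key b a hab
    exact ⟨u, hu, .inr hd⟩

theorem mul_notMem_of_notMem {P : Ideal R} [hP : P.IsPrime] {a b : R} (ha : a ∉ P) (hb : b ∉ P) :
    a * b ∉ P :=
  fun h ↦ (hP.mem_or_mem h).elim ha hb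

theorem TotalDvdAt.exists_forall_dvd {P : Ideal R} [P.IsPrime] (h : TotalDvdAt P) {α : Type*}
    (g : α → R) {S : Finset α} (hS : S.Nonempty) :
    ∃ a ∈ S, ∃ u ∉ P, ∀ b ∈ S, g a ∣ u * g b := by
  induction hS using Finset.Nonempty.cons_induction with
  | singleton a =>
    refine ⟨a, by simp, 1, (Ideal.ne_top_iff_one P).1 (Ideal.IsPrime.ne_top ‹_›), ?_⟩
    simp
  | cons b S hb hS ih =>
    obtain ⟨a, ha, w, hw, hdvd⟩ := ih
    obtain ⟨t, ht, hab | hba⟩ := h (g a) (g b)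
    · refine ⟨a, by simp [ha], w * t, mul_notMem_of_notMem hw ht, fun c hc ↦ ?_⟩
      rcases Finset.mem_cons.1 hc with rfl | hc
      · rw [mul_assoc]
        exact hab.mul_left _
      · rw [mul_right_comm]
        exact (hdvd c hc).mul_right _
    · refine ⟨b, by simp, w * t, mul_notMem_of_notMem hw ht, fun c hc ↦ ?_⟩
      rcases Finset.mem_cons.1 hc with rfl | hc
      · exact dvd_mul_left _ _
      · rw [mul_comm w, mul_assoc]
        exact hba.trans (mul_dvd_mul_left _ (hdvd c hc))

/-- Membership in a submodule is local at the maximal ideals. -/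
theorem Submodule.mem_of_forall_isMaximal (F : Submodule R M) (m : M)
    (h : ∀ P : Ideal R, P.IsMaximal → ∃ w ∉ P, w • m ∈ F) : m ∈ F := by
  by_contra hm
  let I : Ideal R := F.comap (LinearMap.toSpanSingleton R M m)
  have hI : I ≠ ⊤ := fun hI ↦ hm (by
    have : (1 : R) ∈ I := hI ▸ Submodule.mem_top
    simpa [I] using this)
  obtain ⟨P, hP, hIP⟩ := Ideal.exists_le_maximal I hI
  obtain ⟨w, hw, hwm⟩ := h P hP
  exact hw (hIP (by simpa [I] using hwm))

/-! ### Purity from relative divisibility -/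

/-- Relative divisibility: `F` is relatively divisible in `M` if `rF = rM ∩ F` for all `r`. -/
def IsRDSubmodule (F : Submodule R M) : Prop :=
  ∀ (r : R) (m : M), r • m ∈ F → ∃ f ∈ F, r • f = r • m

/-- Over a ring where divisibility is total at `P`, finite linear systems with constants in a
relatively divisible submodule `F` that are solvable in `M` are, up to a factor outside `P`,
solvable in `F`. -/
theorem IsRDSubmodule.exists_solution {F : Submodule R M} (hF : IsRDSubmodule F) {P : Ideal R}
    [P.IsPrime] (hP : TotalDvdAt P) {ι κ : Type*} [Fintype ι] (s : Finset κ)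
    (r : ι → κ → R) (m : κ → M) (h : ∀ i, ∑ j ∈ s, r i j • m j ∈ F) :
    ∃ w ∉ P, ∃ z : κ → M, (∀ j, z j ∈ F) ∧
      ∀ i, ∑ j ∈ s, r i j • z j = w • ∑ j ∈ s, r i j • m j := by
  classical
  induction hn : s.card generalizing s r m with
  | zero =>
    obtain rfl := Finset.card_eq_zero.1 hn
    exact ⟨1, (Ideal.ne_top_iff_one P).1 (Ideal.IsPrime.ne_top ‹_›), 0, by simp, by simp⟩
  | succ n ih =>
    rcases isEmpty_or_nonempty ι with hι | hι
    · exact ⟨1, (Ideal.ne_top_iff_one P).1 (Ideal.IsPrime.ne_top ‹_›), 0, by simp, hι.elim⟩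
    have hs : s.Nonempty := Finset.card_pos.1 (by omega)
    obtain ⟨⟨i₀, j₀⟩, hij, w, hw, hdvd⟩ := hP.exists_forall_dvd (fun p : ι × κ ↦ r p.1 p.2)
      (Finset.univ_nonempty.product hs)
    simp only [Finset.mem_product, Finset.mem_univ, true_and, Prod.forall] at hij hdvd
    choose! c hc using hdvd
    obtain ⟨t, ht, rfl⟩ : ∃ t, j₀ ∉ t ∧ insert j₀ t = s :=
      ⟨s.erase j₀, by simp, Finset.insert_erase hij⟩
    -- Eliminate the unknown `j₀`: the pivot `r i₀ j₀` divides `w` times every coefficient.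
    let r' : ι → κ → R := fun i j ↦ w ^ 2 * r i j - w * c i j₀ * r i₀ j
    have hr'0 (i) : r' i j₀ = 0 := by
      have := hc i j₀ hij
      simp only [r']
      linear_combination w * this
    have hsum (i) (y : κ → M) : ∑ j ∈ t, r' i j • y j =
        w ^ 2 • ∑ j ∈ insert j₀ t, r i j • y j -
          (w * c i j₀) • ∑ j ∈ insert j₀ t, r i₀ j • y j := by
      have h1 : ∑ j ∈ t, r' i j • y j = ∑ j ∈ insert j₀ t, r' i j • y j := by
        rw [Finset.sum_insert ht, hr'0, zero_smul, zero_add]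
      rw [h1, Finset.smul_sum, Finset.smul_sum, ← Finset.sum_sub_distrib]
      refine Finset.sum_congr rfl fun j _ ↦ ?_
      simp only [r', sub_smul, mul_smul]
    obtain ⟨v, hv, z, hz, hzeq⟩ := ih t r' m
      (fun i ↦ by
        rw [hsum]
        exact F.sub_mem (F.smul_mem _ (h i)) (F.smul_mem _ (h i₀)))
      (by rw [Finset.card_insert_of_notMem ht] at hn; omega)
    have hpiv (y : κ → M) : r i₀ j₀ • ∑ j ∈ t, c i₀ j • y j = w • ∑ j ∈ t, r i₀ j • y j := by
      rw [Finset.smul_sum, Finset.smul_sum]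
      refine Finset.sum_congr rfl fun j hj ↦ ?_
      rw [smul_smul, smul_smul, hc i₀ j (Finset.mem_insert_of_mem hj)]
    have hm' : r i₀ j₀ • (w • m j₀ + ∑ j ∈ t, c i₀ j • m j) =
        w • ∑ j ∈ insert j₀ t, r i₀ j • m j := by
      rw [Finset.sum_insert ht, smul_add, smul_add, hpiv, smul_comm]
    -- After scaling by `w`, the pivot row is one divisibility by the pivot, so `f` solves it in
    -- `F`; back-substitution then gives `Z`.
    obtain ⟨f, hfF, hf⟩ := hF (r i₀ j₀) (w • m j₀ + ∑ j ∈ t, c i₀ j • m j)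
      (hm' ▸ F.smul_mem _ (h i₀))
    let Z : κ → M := fun j ↦ if j = j₀ then v • f - ∑ j ∈ t, c i₀ j • z j else w • z j
    have hZF (j) : Z j ∈ F := by
      simp only [Z]
      split_ifs
      · exact F.sub_mem (F.smul_mem _ hfF) (F.sum_mem fun j _ ↦ F.smul_mem _ (hz j))
      · exact F.smul_mem _ (hz j)
    have hZt (a : κ → R) : ∑ j ∈ t, a j • Z j = w • ∑ j ∈ t, a j • z j := by
      rw [Finset.smul_sum]
      refine Finset.sum_congr rfl fun j hj ↦ ?_
      have : j ≠ j₀ := fun hjj ↦ ht (hjj ▸ hj)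
      simp only [Z, if_neg this]
      rw [smul_comm]
    have hrow₀ : ∑ j ∈ insert j₀ t, r i₀ j • Z j =
        (w * v) • ∑ j ∈ insert j₀ t, r i₀ j • m j := by
      rw [mul_comm, mul_smul, ← hm', ← hf, Finset.sum_insert ht, hZt, ← hpiv]
      simp only [Z, if_true]
      rw [smul_sub, smul_comm v]
      abel
    refine ⟨w ^ 2 * (w * v), ?_, fun j ↦ w ^ 2 • Z j, fun j ↦ F.smul_mem _ (hZF j), fun i ↦ ?_⟩
    · rw [pow_two]
      exact mul_notMem_of_notMem (mul_notMem_of_notMem hw hw) (mul_notMem_of_notMem hw hv)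
    have h1 : w ^ 2 • ∑ j ∈ insert j₀ t, r i j • Z j =
        ∑ j ∈ t, r' i j • Z j + (w * c i j₀) • ∑ j ∈ insert j₀ t, r i₀ j • Z j := by
      rw [hsum, sub_add_cancel]
    have h2 : ∑ j ∈ insert j₀ t, r i j • w ^ 2 • Z j =
        w ^ 2 • ∑ j ∈ insert j₀ t, r i j • Z j := by
      rw [Finset.smul_sum]
      exact Finset.sum_congr rfl fun j _ ↦ smul_comm _ _ _
    rw [h2, h1, hZt, hzeq, hsum, hrow₀]
    module

-- By the equational criterion, the vanishing of `∑ n i ⊗ y i` in `N ⊗ M` is witnessed by a linear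
-- system solvable in `M`. Solving it in `F` locally at `P` kills the tensor up to a factor outside
-- `P`.
open TensorProduct in
theorem IsRDSubmodule.lTensor_injective_of_finite {F : Submodule R M} (hF : IsRDSubmodule F)
    (hR : ∀ P : Ideal R, P.IsMaximal → TotalDvdAt P) (N : Type*) [AddCommGroup N] [Module R N]
    [Module.Finite R N] : Function.Injective (F.subtype.lTensor N) := by
  rw [injective_iff_map_eq_zero]
  intro t ht
  obtain ⟨k, n, hn⟩ := Module.Finite.exists_fin (R := R) (M := N)
  obtain ⟨y, rfl⟩ : ∃ y : Fin k → F, t = ∑ i, n i ⊗ₜ[R] y i := by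
    clear ht
    induction t with
    | zero => exact ⟨0, by simp⟩
    | add a b ha hb =>
      obtain ⟨ya, rfl⟩ := ha
      obtain ⟨yb, rfl⟩ := hb
      exact ⟨ya + yb, by simp [tmul_add, Finset.sum_add_distrib]⟩
    | tmul a f =>
      obtain ⟨c, rfl⟩ := (Submodule.mem_span_range_iff_exists_fun R).1
        (hn ▸ Submodule.mem_top : a ∈ Submodule.span R (Set.range n))
      exact ⟨fun i ↦ c i • f, by simp [sum_tmul, smul_tmul]⟩
  obtain ⟨l, a, m, hm, ha⟩ := vanishesTrivially_of_sum_tmul_eq_zero R hn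
    (n := fun i ↦ (y i : M)) (by simpa using ht)
  rw [← Submodule.mem_bot R]
  refine Submodule.mem_of_forall_isMaximal _ _ fun P hPm ↦ ?_
  obtain ⟨w, hw, z, hz, hzeq⟩ := hF.exists_solution (hR P hPm) Finset.univ a m
    (fun i ↦ hm i ▸ (y i).2)
  refine ⟨w, hw, ?_⟩
  have h1 (i) : w • y i = ∑ j, a i j • (⟨z j, hz j⟩ : F) := by
    ext
    simp [hzeq, hm]
  rw [Submodule.mem_bot, Finset.smul_sum]
  simp_rw [← tmul_smul, h1]
  exact sum_tmul_eq_zero_of_vanishesTrivially R ⟨l, a, _, fun i ↦ rfl, ha⟩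

open TensorProduct in
theorem IsRDSubmodule.isPureSubmodule {F : Submodule R M} (hF : IsRDSubmodule F)
    (hR : ∀ P : Ideal R, P.IsMaximal → TotalDvdAt P) : IsPureSubmodule F := by
  intro N _ _
  rw [← LinearMap.lTensor_inj_iff_rTensor_inj, injective_iff_map_eq_zero]
  intro t ht
  obtain ⟨Q, hQ, t, rfl⟩ := TensorProduct.exists_of_fg t
  have hcomm {A B : Type (max u v)} [AddCommGroup A] [Module R A] [AddCommGroup B] [Module R B]
      (g : A →ₗ[R] B) (x : A ⊗[R] F) : F.subtype.lTensor B (g.rTensor F x) =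
        g.rTensor M (F.subtype.lTensor A x) := by
    rw [← LinearMap.comp_apply, ← LinearMap.comp_apply, LinearMap.lTensor_comp_rTensor,
      LinearMap.rTensor_comp_lTensor]
  rw [hcomm] at ht
  obtain ⟨Q', hle, hQ', h⟩ := TensorProduct.eq_zero_of_fg_of_subtype_eq_zero hQ ht
  have : Module.Finite R Q' := Module.Finite.iff_fg.2 hQ'
  rw [← hcomm] at h
  have h0 := (injective_iff_map_eq_zero _).1 (hF.lTensor_injective_of_finite hR Q') _ h
  rw [← Submodule.subtype_comp_inclusion _ _ hle, LinearMap.rTensor_comp, LinearMap.comp_apply, h0,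
    map_zero]

/-! ### Elements faithful at maximal ideals -/

theorem Submodule.exists_notMem_smul_mem_of_sup_eq_top [Module.Finite R M] {K : Submodule R M}
    {P : Ideal R} (hP : P ≠ ⊤) (h : K ⊔ P • (⊤ : Submodule R M) = ⊤) :
    ∃ w ∉ P, ∀ m, w • m ∈ K := by
  obtain ⟨w, hw, hle⟩ := Submodule.exists_sub_one_mem_and_smul_le_of_fg_of_le_sup
    (Module.Finite.fg_top (R := R) (M := M)) le_rfl h.ge
  refine ⟨w, fun hwP ↦ hP ((Ideal.eq_top_iff_one P).2 ?_), fun m ↦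
    hle (Submodule.smul_mem_pointwise_smul m w ⊤ Submodule.mem_top)⟩
  simpa using P.sub_mem hwP hw

instance isNoetherian_quotient_smul_top [Module.Finite R M] (P : Ideal R) [P.IsMaximal] :
    IsNoetherian R (M ⧸ P • (⊤ : Submodule R M)) := by
  have : Module.Finite (R ⧸ P) (M ⧸ P • (⊤ : Submodule R M)) :=
    Module.Finite.of_restrictScalars_finite R _ _
  have : IsSimpleModule R (R ⧸ P) := isSimpleModule_iff_isCoatom.2 (Ideal.isMaximal_def.1 ‹_›)
  obtain ⟨k, f, hf⟩ := Module.Finite.exists_fin' (R ⧸ P) (M ⧸ P • (⊤ : Submodule R M))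
  exact isNoetherian_of_surjective (f.restrictScalars R) (LinearMap.range_eq_top.2 hf)

/-- The preimage in `M` of the `s`-torsion of the localization of `M ⧸ F` at `P`. -/
def Submodule.torsionAt (F : Submodule R M) (P : Ideal R) [P.IsPrime] (s : R) :
    Submodule R M where
  carrier := {m | ∃ w ∉ P, (w * s) • m ∈ F}
  zero_mem' := ⟨1, (Ideal.ne_top_iff_one P).1 (Ideal.IsPrime.ne_top ‹_›), by simp⟩
  add_mem' := by
    rintro a b ⟨w, hw, ha⟩ ⟨t, ht, hb⟩
    refine ⟨w * t, mul_notMem_of_notMem hw ht, ?_⟩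
    have : (w * t * s) • (a + b) = t • (w * s) • a + w • (t * s) • b := by module
    rw [this]
    exact F.add_mem (F.smul_mem _ ha) (F.smul_mem _ hb)
  smul_mem' := by
    rintro c a ⟨w, hw, ha⟩
    refine ⟨w, hw, ?_⟩
    rw [smul_comm]
    exact F.smul_mem _ ha

theorem Submodule.torsionAt_le_of_dvd (F : Submodule R M) (P : Ideal R) [P.IsPrime] {a b t : R}
    (ht : t ∉ P) (h : a ∣ t * b) : F.torsionAt P a ≤ F.torsionAt P b := by
  rintro m ⟨w, hw, hm⟩
  obtain ⟨c, hc⟩ := h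
  refine ⟨w * t, mul_notMem_of_notMem hw ht, ?_⟩
  have : (w * t * b) • m = c • (w * a) • m := by
    rw [mul_assoc, hc]
    module
  rw [this]
  exact F.smul_mem _ hm

/-- At `P`, every element of `M ⧸ F` congruent to `x` modulo `P` has the same annihilator as
`M ⧸ F`. -/
def IsFaithfulAt (F : Submodule R M) (P : Ideal R) (x : M) : Prop :=
  ∀ (y : M) (s : R), x - y ∈ P • (⊤ : Submodule R M) → s • y ∈ F →
    ∃ w ∉ P, ∀ m : M, (w * s) • m ∈ F

theorem exists_isFaithfulAt [Module.Finite R M] (F : Submodule R M) {P : Ideal R} [P.IsMaximal]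
    (hP : TotalDvdAt P) : ∃ x : M, IsFaithfulAt F P x := by
  let PM : Submodule R M := P • ⊤
  let T : Set (Submodule R (M ⧸ PM)) :=
    {K | ∃ s, (∀ w ∉ P, ∃ m : M, (w * s) • m ∉ F) ∧ K = (F.torsionAt P s).map PM.mkQ}
  rcases T.eq_empty_or_nonempty with hT | hT
  · refine ⟨0, fun y s _ _ ↦ ?_⟩
    by_contra! hs
    exact (Set.eq_empty_iff_forall_notMem.1 hT) _ ⟨s, hs, rfl⟩
  obtain ⟨K, ⟨s₀, hs₀, rfl⟩, hK⟩ :=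
    set_has_maximal_iff_noetherian.2 (isNoetherian_quotient_smul_top P) T hT
  -- Otherwise, by Nakayama, `s₀` would kill each generator of `M ⧸ F` locally, hence all of it.
  have hne : F.torsionAt P s₀ ⊔ PM ≠ ⊤ := by
    intro htop
    obtain ⟨w, hw, hwm⟩ := Submodule.exists_notMem_smul_mem_of_sup_eq_top
      (Ideal.IsPrime.ne_top inferInstance) htop
    obtain ⟨S, hS⟩ := Module.Finite.fg_top (R := R) (M := M)
    have key : ∀ S : Finset M, ∃ t ∉ P, ∀ m ∈ S, (t * s₀) • m ∈ F := by
      classical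
      intro S
      induction S using Finset.induction_on with
      | empty => exact ⟨1, (Ideal.ne_top_iff_one P).1 (Ideal.IsPrime.ne_top inferInstance), by simp⟩
      | insert a S ha ih =>
        obtain ⟨t, ht, htm⟩ := ih
        obtain ⟨v, hv, hva⟩ := hwm a
        refine ⟨t * (v * w), mul_notMem_of_notMem ht (mul_notMem_of_notMem hv hw),
          fun m hm ↦ ?_⟩
        rcases Finset.mem_insert.1 hm with rfl | hm
        · have : (t * (v * w) * s₀) • m = t • (v * s₀) • w • m := by module
          exact this ▸ F.smul_mem _ hva
        · have : (t * (v * w) * s₀) • m = (v * w) • (t * s₀) • m := by module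
          exact this ▸ F.smul_mem _ (htm m hm)
    obtain ⟨t, ht, htm⟩ := key S
    obtain ⟨m, hm⟩ := hs₀ t ht
    have hle : Submodule.span R (S : Set M) ≤ F.comap (LinearMap.lsmul R M (t * s₀)) :=
      Submodule.span_le.2 htm
    exact hm (hle (hS ▸ Submodule.mem_top))
  obtain ⟨x, -, hx⟩ := SetLike.exists_of_lt hne.lt_top
  refine ⟨x, fun y s hxy hsy ↦ ?_⟩
  by_contra! hs
  -- Total divisibility makes the torsion submodules a chain, so a maximal image is the largest.
  have hle : (F.torsionAt P s).map PM.mkQ ≤ (F.torsionAt P s₀).map PM.mkQ := by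
    obtain ⟨w, hw, h | h⟩ := hP s s₀
    · exact Submodule.map_mono (F.torsionAt_le_of_dvd P hw h)
    · have h1 := Submodule.map_mono (f := PM.mkQ) (F.torsionAt_le_of_dvd P hw h)
      exact (eq_of_le_of_not_lt h1 (hK _ ⟨s, hs, rfl⟩)).ge
  have hy : y ∈ F.torsionAt P s :=
    ⟨1, (Ideal.ne_top_iff_one P).1 (Ideal.IsPrime.ne_top inferInstance), by simpa using hsy⟩
  obtain ⟨y', hy', hyy⟩ := hle (Submodule.mem_map_of_mem hy)
  have hyy' : y - y' ∈ PM := (Submodule.Quotient.eq PM).1 hyy.symm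
  apply hx
  have : x = y' + ((x - y) + (y - y')) := by abel
  rw [this]
  exact Submodule.add_mem_sup hy' (PM.add_mem hxy hyy')

theorem IsFaithfulAt.congr {F : Submodule R M} {P : Ideal R} {x x' : M} (h : IsFaithfulAt F P x)
    (hx : x' - x ∈ P • (⊤ : Submodule R M)) : IsFaithfulAt F P x' := by
  intro y s hy hs
  refine h y s ?_ hs
  have : x - y = (x' - y) - (x' - x) := by abel
  exact this ▸ Submodule.sub_mem _ hy hx

theorem exists_forall_isFaithfulAt [Module.Finite R M] (hsl : IsSemilocalRing R)
    (hR : ∀ P : Ideal R, P.IsMaximal → TotalDvdAt P) (F : Submodule R M) :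
    ∃ x : M, ∀ P : Ideal R, P.IsMaximal → IsFaithfulAt F P x := by
  classical
  have : Fintype {P : Ideal R | P.IsMaximal} := hsl.fintype
  let ι := {P : Ideal R | P.IsMaximal}
  have hex (P : ι) : ∃ x : M, IsFaithfulAt F P.1 x :=
    have : P.1.IsMaximal := P.2
    exists_isFaithfulAt F (hR P.1 P.2)
  choose x hx using hex
  have hcop : Pairwise (Function.onFun IsCoprime fun P : ι ↦ P.1) := fun P Q hPQ ↦
    Ideal.isCoprime_iff_sup_eq.2 (P.2.coprime_of_ne Q.2 fun h ↦ hPQ (Subtype.ext h))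
  choose e he using fun P : ι ↦ Ideal.exists_forall_sub_mem_ideal hcop (Pi.single P (1 : R))
  refine ⟨∑ Q, e Q • x Q, fun P hP ↦ (hx ⟨P, hP⟩).congr ?_⟩
  have : ∑ Q, e Q • x Q - x ⟨P, hP⟩ =
      ∑ Q, (e Q - (Pi.single Q (1 : R) : ι → R) ⟨P, hP⟩) • x Q := by
    simp only [sub_smul, Finset.sum_sub_distrib]
    congr 1
    rw [Finset.sum_eq_single ⟨P, hP⟩] <;> simp +contextual [eq_comm]
  rw [this]
  exact Submodule.sum_mem _ fun Q _ ↦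
    Submodule.smul_mem_smul (he Q ⟨P, hP⟩) Submodule.mem_top

/-! ### Adjoining a faithful element -/

section Step

variable {F : Submodule R M} {x : M} (hx : ∀ P : Ideal R, P.IsMaximal → IsFaithfulAt F P x)

include hx

theorem smul_mem_of_forall_isFaithfulAt {s : R} (hs : s • x ∈ F) (m : M) : s • m ∈ F := by
  refine F.mem_of_forall_isMaximal _ fun P hP ↦ ?_
  obtain ⟨w, hw, h⟩ := hx P hP x s (by simp) hs
  exact ⟨w, hw, by simpa [mul_smul] using h m⟩

theorem IsRDSubmodule.sup_span_singleton (hR : ∀ P : Ideal R, P.IsMaximal → TotalDvdAt P)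
    (hF : IsRDSubmodule F) : IsRDSubmodule (F ⊔ Submodule.span R {x}) := by
  intro r m hrm
  obtain ⟨f, hf, y, hy, hfy⟩ := Submodule.mem_sup.1 hrm
  obtain ⟨s, rfl⟩ := Submodule.mem_span_singleton.1 hy
  -- Once `s • x` is absorbed into `F + R(r • x)`, subtracting a multiple of `x` from `m` reduces to
  -- divisibility in `F`.
  have key : s • x ∈ F ⊔ Submodule.span R {r • x} := by
    refine Submodule.mem_of_forall_isMaximal _ _ fun P hP ↦ ?_
    have hmem (c : R) : c • r • x ∈ F ⊔ Submodule.span R {r • x} :=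
      Submodule.mem_sup_right (Submodule.mem_span_singleton.2 ⟨c, rfl⟩)
    obtain ⟨w, hw, ⟨c, hc⟩ | ⟨c, hc⟩⟩ := hR P hP r s
    · refine ⟨w, hw, ?_⟩
      have : w • s • x = c • r • x := by
        rw [smul_smul, hc]
        module
      exact this ▸ hmem c
    -- Here `w * r = s * c`. If `c ∈ P`, the element `x - (c/w) m` of the localization is congruent
    -- to `x` and killed by `s` modulo `F`, so faithfulness makes `s` kill `M ⧸ F` locally.
    by_cases hcP : c ∈ P
    · obtain ⟨d, p, hp, hdp⟩ := Ideal.IsMaximal.exists_inv hP hw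
      have hy : s • (d • (w • x - c • m)) ∈ F := by
        have h1 : s • (d • (w • x - c • m)) = -((d * w) • f) := by
          have h2 : s • c • m = w • (f + s • x) := by rw [hfy, smul_smul, ← hc, mul_smul]
          rw [smul_comm s d, smul_sub, h2]
          module
        rw [h1]
        exact F.neg_mem (F.smul_mem _ hf)
      have hxy : x - d • (w • x - c • m) ∈ P • (⊤ : Submodule R M) := by
        have h1 : x - d • (w • x - c • m) = p • x + (d * c) • m := by
          have h2 : x = (d * w + p) • x := by rw [hdp, one_smul]
          nth_rw 1 [h2]
          module
        rw [h1]
        exact Submodule.add_mem _ (Submodule.smul_mem_smul hp Submodule.mem_top)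
          (Submodule.smul_mem_smul (P.mul_mem_left d hcP) Submodule.mem_top)
      obtain ⟨v, hv, h⟩ := hx P hP _ s hxy hy
      exact ⟨v, hv, Submodule.mem_sup_left (by simpa [mul_smul] using h x)⟩
    · refine ⟨c, hcP, ?_⟩
      have : c • s • x = w • r • x := by
        rw [smul_smul, smul_smul, hc, mul_comm]
      exact this ▸ hmem w
  obtain ⟨f₁, hf₁, y, hy, hsx⟩ := Submodule.mem_sup.1 key
  obtain ⟨t, rfl⟩ := Submodule.mem_span_singleton.1 hy
  have h1 : r • (m - t • x) = f + f₁ := by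
    rw [smul_sub, ← hfy, ← hsx]
    module
  obtain ⟨f₂, hf₂, h2⟩ := hF r (m - t • x) (h1 ▸ F.add_mem hf hf₁)
  refine ⟨f₂ + t • x, Submodule.add_mem_sup hf₂
    (Submodule.mem_span_singleton.2 ⟨t, rfl⟩), ?_⟩
  rw [smul_add, h2]
  module

/-- If `x` were congruent to some `f ∈ F`, faithfulness with `s = 1` would make `M ⧸ F` vanish at
`P`. -/
theorem notMem_sup_smul_top_of_forall_isFaithfulAt {P : Ideal R}
    [hP : P.IsMaximal] (h : F ⊔ P • (⊤ : Submodule R M) ≠ ⊤) :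
    x ∉ F ⊔ P • (⊤ : Submodule R M) := by
  intro hmem
  obtain ⟨f, hf, y, hy, rfl⟩ := Submodule.mem_sup.1 hmem
  obtain ⟨w, hw, hwF⟩ := hx P hP f 1 (by simpa using hy) (by simpa using hf)
  obtain ⟨d, p, hp, hdp⟩ := Ideal.IsMaximal.exists_inv hP hw
  refine h ((Submodule.eq_top_iff').2 fun m ↦ ?_)
  have : m = d • (w * 1) • m + p • m := by
    conv_lhs => rw [← one_smul R m, ← hdp]
    module
  rw [this]
  exact Submodule.add_mem_sup (F.smul_mem _ (hwF m)) (Submodule.smul_mem_smul hp Submodule.mem_top)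

end Step

/-! ### The chain and its termination -/

theorem Submodule.exists_isMaximal_sup_smul_ne_top [Module.Finite R M] {F : Submodule R M}
    (hF : F ≠ ⊤) : ∃ P : Ideal R, P.IsMaximal ∧ F ⊔ P • (⊤ : Submodule R M) ≠ ⊤ := by
  by_contra! h
  refine hF ((Submodule.eq_top_iff').2 fun m ↦ F.mem_of_forall_isMaximal m fun P hP ↦ ?_)
  obtain ⟨w, hw, hwm⟩ := Submodule.exists_notMem_smul_mem_of_sup_eq_top hP.ne_top (h P hP)
  exact ⟨w, hw, hwm m⟩

/-- A finitely generated module over a semilocal arithmetic ring is exhausted by successively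
adjoining elements that are faithful at all maximal ideals. -/
theorem exists_isRDSubmodule_chain [Module.Finite R M] (hsl : IsSemilocalRing R)
    (hR : ∀ P : Ideal R, P.IsMaximal → TotalDvdAt P) :
    ∃ (n : ℕ) (g : ℕ → Submodule R M) (x : ℕ → M), g 0 = ⊥ ∧ g n = ⊤ ∧
      (∀ k < n, g k < g (k + 1)) ∧ (∀ k, IsRDSubmodule (g k)) ∧
      (∀ k, g (k + 1) = g k ⊔ Submodule.span R {x k}) ∧
      ∀ (k : ℕ) (r : R), r • x k ∈ g k → ∀ m, r • m ∈ g k := by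
  choose x hx using exists_forall_isFaithfulAt (M := M) hsl hR
  let g : ℕ → Submodule R M := Nat.rec ⊥ fun _ F ↦ F ⊔ Submodule.span R {x F}
  have hg (k) : g (k + 1) = g k ⊔ Submodule.span R {x (g k)} := rfl
  have hgRD (k) : IsRDSubmodule (g k) := by
    induction k with
    | zero => exact fun r m hm ↦ ⟨0, (g 0).zero_mem, by
        rw [smul_zero]; exact ((Submodule.mem_bot R).1 hm).symm⟩
    | succ k ih => exact ih.sup_span_singleton (hx _) hR
  have hgmono : Monotone g := monotone_nat_of_le_succ fun k ↦ le_sup_left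
  have hxmem (k) : x (g k) ∈ g (k + 1) :=
    Submodule.mem_sup_right (Submodule.mem_span_singleton_self _)
  have hnotMem {k} {P : Ideal R} (hP : P.IsMaximal) (h : g k ⊔ P • (⊤ : Submodule R M) ≠ ⊤) :
      x (g k) ∉ g k ⊔ P • (⊤ : Submodule R M) :=
    notMem_sup_smul_top_of_forall_isFaithfulAt (hx _) h
  have hlt {k} (h : g k ≠ ⊤) : g k < g (k + 1) := by
    obtain ⟨P, hP, hne⟩ := Submodule.exists_isMaximal_sup_smul_ne_top h
    refine lt_of_le_of_ne (hgmono k.le_succ) fun heq ↦ hnotMem hP hne ?_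
    exact Submodule.mem_sup_left (heq.ge (hxmem k))
  have hstab (P : Ideal R) (hP : P.IsMaximal) :
      ∃ n, ∀ k, n ≤ k → g k ⊔ P • (⊤ : Submodule R M) = ⊤ := by
    obtain ⟨n, hn⟩ := monotone_stabilizes_iff_noetherian.2
      (isNoetherian_quotient_smul_top (M := M) P)
      ⟨fun k ↦ (g k).map (P • (⊤ : Submodule R M)).mkQ,
        fun a b hab ↦ Submodule.map_mono (hgmono hab)⟩
    have htop : g n ⊔ P • (⊤ : Submodule R M) = ⊤ := by
      by_contra hne
      refine hnotMem hP hne ?_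
      have h1 := congrArg (Submodule.comap (P • (⊤ : Submodule R M)).mkQ) (hn (n + 1) n.le_succ)
      change Submodule.comap _ (Submodule.map _ _) = Submodule.comap _ (Submodule.map _ _) at h1
      rw [Submodule.comap_map_mkQ, Submodule.comap_map_mkQ] at h1
      rw [sup_comm, h1]
      exact Submodule.mem_sup_right (hxmem n)
    exact ⟨n, fun k hk ↦ top_unique (htop.ge.trans (sup_le_sup_right (hgmono hk) _))⟩
  have hex : ∃ n, g n = ⊤ := by
    choose! n hn using hstab
    -- Finitely many maximal ideals allow one bound for all of them.
    obtain ⟨N, hN⟩ := (hsl.image n).bddAbove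
    refine ⟨N, of_not_not fun hne ↦ ?_⟩
    obtain ⟨P, hP, hPne⟩ := Submodule.exists_isMaximal_sup_smul_ne_top hne
    exact hPne (hn P hP N (hN ⟨P, hP, rfl⟩))
  obtain ⟨n, hn, hmin⟩ : ∃ n, g n = ⊤ ∧ ∀ k < n, g k ≠ ⊤ := by
    classical
    exact ⟨Nat.find hex, Nat.find_spec hex, fun k hk ↦ Nat.find_min hex hk⟩
  exact ⟨n, g, fun k ↦ x (g k), rfl, hn, fun k hk ↦ hlt (hmin k hk), hgRD, hg,
    fun k r hr m ↦ smul_mem_of_forall_isFaithfulAt (hx _) hr m⟩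

theorem Submodule.exists_span_singleton_eq_top_of_eq_sup {N₁ N₂ : Submodule R M} {x : M}
    (h : N₂ = N₁ ⊔ span R {x}) : ∃ q : N₂ ⧸ N₁.submoduleOf N₂, span R {q} = ⊤ := by
  have hx : x ∈ N₂ := h ▸ mem_sup_right (mem_span_singleton_self x)
  refine ⟨Quotient.mk ⟨x, hx⟩, eq_top_iff'.2 fun q ↦ ?_⟩
  obtain ⟨⟨q, hq⟩, rfl⟩ := Quotient.mk_surjective _ q
  obtain ⟨f, hf, y, hy, hfy⟩ := mem_sup.1 (h ▸ hq)
  obtain ⟨t, rfl⟩ := mem_span_singleton.1 hy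
  refine mem_span_singleton.2 ⟨t, ?_⟩
  rw [← Quotient.mk_smul, Quotient.eq, submoduleOf, mem_comap]
  simpa [← hfy] using hf

theorem Submodule.mem_annihilator_quotient_submoduleOf {N₁ N₂ : Submodule R M} {r : R} :
    r ∈ Module.annihilator R (N₂ ⧸ N₁.submoduleOf N₂) ↔ ∀ m ∈ N₂, r • m ∈ N₁ := by
  have key (m : N₂) : r • (Quotient.mk m : N₂ ⧸ N₁.submoduleOf N₂) = 0 ↔ r • (m : M) ∈ N₁ := by
    rw [← Quotient.mk_smul, Quotient.mk_eq_zero, submoduleOf, mem_comap]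
    rfl
  rw [Module.mem_annihilator, (Quotient.mk_surjective _).forall]
  simp only [key, Subtype.forall]

end

theorem mainTheorem9 (R : Type u) [CommRing R] (hsemilocal : IsSemilocalRing R)
    (harith : IsArithmeticRing R) (M : Type v) [AddCommGroup M] [Module R M] [Module.Finite R M] :
    ∃ s : PureCompositionSeries R M, s.HasCyclicFactors ∧ Monotone s.annihilatorSequence := by
  have hR (P : Ideal R) (hP : P.IsMaximal) : TotalDvdAt P := harith.totalDvdAt P
  obtain ⟨n, g, x, h0, hn, hlt, hRD, hg, hann⟩ :=
    exists_isRDSubmodule_chain (M := M) hsemilocal hR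
  have hmono : Monotone g := monotone_nat_of_le_succ fun k ↦ hg k ▸ le_sup_left
  have hx (k) : x k ∈ g (k + 1) :=
    hg k ▸ Submodule.mem_sup_right (Submodule.mem_span_singleton_self _)
  refine ⟨⟨n, fun i ↦ g i, Fin.strictMono_iff_lt_succ.2 fun i ↦ hlt i i.2, h0, hn,
    fun i ↦ (hRD i).isPureSubmodule hR⟩, fun i ↦ ?_, fun i j hij r hr ↦ ?_⟩
  · exact Submodule.exists_span_singleton_eq_top_of_eq_sup (hg i)
  · refine Submodule.mem_annihilator_quotient_submoduleOf.2 fun m _ ↦ hmono hij ?_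
    -- A scalar killing the factor kills `x i` modulo `g i`, hence sends all of `M` into `g i`.
    exact hann i r (Submodule.mem_annihilator_quotient_submoduleOf.1 hr _ (hx i)) m
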